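/- Let $G$ be a finite group and let $H\le G$ be a core-free subgroup (that is, $\bigcap_{g\in G} gHg^{-1}=1$). Let $S\subseteq G$ be a transversal of $H$ in $G$, i.e. $1\in S$ and $S$ contains exactly one element of each right coset $Hg$; then $S$ is a right loop under the operation defined by $\{x\circ y\}=S\cap Hxy$. (A right loop is a set with a binary operation that has a two-sided identity and in which every equation $X\circ a=b$ has a unique solution $X$.) Suppose that $S$ generates $G$, that the right loop $(S,\circ)$ is nilpotent, and that $|S|=p^n$ for some prime $p$ and some $n\in\mathbb N$. Then both $H$ and $G$ are $p$-groups. Here nilpotency is understood as follows. A congruence on a right loop $L$ is an equivalence relation on $L$ that is a right subloop of $L\times L$. A congruence $\gamma$ centralizes a congruence $\beta$ on $L$ if there is a congruence $\delta$ on the right loop $\beta\subseteq L\times L$ such that: (i) $(x,y)\,\delta\,(u,v)$ implies $x\,\gamma\,u$; (ii) for every $(x,y)\in\beta$, the map $(u,v)\mapsto u$ is a bijection from the $\delta$-class of $(x,y)$ onto the $\gamma$-class of $x$; (iii) $x\,\gamma\,y$ implies $(x,x)\,\delta\,(y,y)$; (iv) $(x,y)\,\delta\,(u,v)$ implies $(y,x)\,\delta\,(v,u)$;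 (v) $(x,y)\,\delta\,(u,v)$ and $(y,z)\,\delta\,(v,w)$ imply $(x,z)\,\delta\,(u,w)$. A congruence is central if it is centralized by $L\times L$. There is a greatest central congruence on $L$, and the center $\mathcal Z(L)$ is its class of the identity. Put $\mathcal Z_0=\{1\}$ and let $\mathcal Z_{i+1}\supseteq\mathcal Z_i$ be determined by $\mathcal Z_{i+1}/\mathcal Z_i=\mathcal Z(L/\mathcal Z_i)$, where $L/\mathcal Z_i$ is the quotient of $L$ by the congruence whose identity class is $\mathcal Z_i$. The right loop $L$ is nilpotent if $\mathcal Z_n=L$ for some $n\in\mathbb N$. -/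

import Mathlib

/-- A right loop: a set with a binary operation that has a two-sided identity and in which every
equation `X * a = b` has exactly one solution `X`. -/
class RightLoop (S : Type*) extends MulOneClass S where
  existsUnique_mul_eq : ∀ a b : S, ∃! x : S, x * a = b

namespace RightLoop

theorem cancel {S : Type*} [RightLoop S] {x y a : S} (h : x * a = y * a) : x = y :=
  (existsUnique_mul_eq a (y * a)).unique h rfl

instance instProd {S T : Type*} [RightLoop S] [RightLoop T] : RightLoop (S × T) where
  existsUnique_mul_eq := by
    rintro ⟨a, a'⟩ ⟨b, b'⟩
    obtain ⟨x, hx, -⟩ := existsUnique_mul_eq a b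
    obtain ⟨x', hx', -⟩ := existsUnique_mul_eq a' b'
    refine ⟨(x, x'), Prod.ext hx hx', ?_⟩
    rintro ⟨y, y'⟩ hy
    have h1 : y * a = b := congrArg Prod.fst hy
    have h2 : y' * a' = b' := congrArg Prod.snd hy
    exact Prod.ext (cancel (h1.trans hx.symm)) (cancel (h2.trans hx'.symm))

/-- A right subloop: a subset that is a right loop for the restricted operation. (Its identity is
automatically the identity of `S`, by right cancellation.) -/
structure IsRightSubloop {S : Type*} [RightLoop S] (T : Set S) : Prop where
  one_mem : (1 : S) ∈ T
  mul_mem : ∀ {x y : S}, x ∈ T → y ∈ T → x * y ∈ T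
  solution_mem : ∀ {x a : S}, a ∈ T → x * a ∈ T → x ∈ T

/-- The right loop structure on a right subloop. -/
abbrev IsRightSubloop.rightLoop {S : Type*} [RightLoop S] {T : Set S} (hT : IsRightSubloop T) :
    RightLoop T where
  mul x y := ⟨x * y, hT.mul_mem x.2 y.2⟩
  one := ⟨1, hT.one_mem⟩
  one_mul x := Subtype.ext (one_mul (x : S))
  mul_one x := Subtype.ext (mul_one (x : S))
  existsUnique_mul_eq := by
    rintro ⟨a, ha⟩ ⟨b, hb⟩
    obtain ⟨x, hx, -⟩ := existsUnique_mul_eq a b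
    refine ⟨⟨x, hT.solution_mem ha (hx.symm ▸ hb)⟩, Subtype.ext hx, ?_⟩
    rintro ⟨y, hyT⟩ hy
    have h1 : y * a = b := congrArg Subtype.val hy
    exact Subtype.ext (cancel (h1.trans hx.symm))

/-- A congruence on a right loop `S`: an equivalence relation on `S` that is a right subloop of
`S × S`. -/
structure Congruence (S : Type*) [RightLoop S] extends Setoid S where
  isRightSubloop : IsRightSubloop {q : S × S | r q.1 q.2}

namespace Congruence

variable {S : Type*} [RightLoop S]

theorem refl (α : Congruence S) (x : S) : α.r x x := α.iseqv.refl x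

theorem symm (α : Congruence S) {x y : S} (h : α.r x y) : α.r y x := α.iseqv.symm h

theorem trans (α : Congruence S) {x y z : S} (h : α.r x y) (h' : α.r y z) : α.r x z :=
  α.iseqv.trans h h'

theorem mul (α : Congruence S) {x y a b : S} (h : α.r x y) (h' : α.r a b) :
    α.r (x * a) (y * b) :=
  α.isRightSubloop.mul_mem (x := (x, y)) (y := (a, b)) h h'

theorem cancel (α : Congruence S) {x y a b : S} (h' : α.r a b) (h : α.r (x * a) (y * b)) :
    α.r x y :=
  α.isRightSubloop.solution_mem (x := (x, y)) (a := (a, b)) h' h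

/-- An equivalence relation compatible with the product and with right division is a congruence. -/
def mk' (s : Setoid S) (hmul : ∀ x y a b : S, s.r x y → s.r a b → s.r (x * a) (y * b))
    (hcancel : ∀ x y a b : S, s.r a b → s.r (x * a) (y * b) → s.r x y) : Congruence S where
  toSetoid := s
  isRightSubloop :=
    { one_mem := s.iseqv.refl 1
      mul_mem := fun {p q} hp hq => hmul p.1 p.2 q.1 q.2 hp hq
      solution_mem := fun {p q} hq hp => hcancel p.1 p.2 q.1 q.2 hq hp }

/-- The equality congruence. -/
def equality (S : Type*) [RightLoop S] : Congruence S :=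
  mk' ⟨fun x y => x = y, ⟨fun _ => rfl, Eq.symm, Eq.trans⟩⟩
    (fun _ _ _ _ h h' => congrArg₂ (· * ·) h h')
    (fun x y a b (h' : a = b) (h : x * a = y * b) => by subst h'; exact RightLoop.cancel h)

/-- The congruence `S × S`. -/
def total (S : Type*) [RightLoop S] : Congruence S :=
  mk' ⟨fun _ _ => True, ⟨fun _ => trivial, fun _ => trivial, fun _ _ => trivial⟩⟩
    (fun _ _ _ _ _ _ => trivial) (fun _ _ _ _ _ _ => trivial)

/-- A congruence as a subset of `S × S`; it is again a right loop. -/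
def graph (β : Congruence S) : Set (S × S) := {q | β.r q.1 q.2}

instance instRightLoopGraph (β : Congruence S) : RightLoop β.graph :=
  IsRightSubloop.rightLoop (T := β.graph) β.isRightSubloop

/-- The pair `(x, y)` as an element of `β`. -/
def pair (β : Congruence S) {x y : S} (h : β.r x y) : β.graph := ⟨(x, y), h⟩

/-- The underlying set of the quotient `S / α`. -/
def Quot (α : Congruence S) : Type _ := Quotient α.toSetoid

/-- The projection of `S` onto `S / α`. -/
def proj (α : Congruence S) (x : S) : α.Quot := Quotient.mk α.toSetoid x

theorem proj_eq (α : Congruence S) {x y : S} : α.proj x = α.proj y ↔ α.r x y :=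
  Quotient.eq (r := α.toSetoid)

theorem proj_surjective (α : Congruence S) : Function.Surjective α.proj :=
  Quotient.mk_surjective

/-- The quotient right loop `S / α`. -/
instance instRightLoopQuot (α : Congruence S) : RightLoop α.Quot where
  mul := Quotient.map₂ (· * ·) fun _ _ h _ _ h' => α.mul h h'
  one := α.proj 1
  one_mul := by
    rintro ⟨x⟩
    exact congrArg α.proj (one_mul x)
  mul_one := by
    rintro ⟨x⟩
    exact congrArg α.proj (mul_one x)
  existsUnique_mul_eq := by
    rintro ⟨a⟩ ⟨b⟩
    obtain ⟨x, hx, -⟩ := existsUnique_mul_eq a b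
    refine ⟨α.proj x, congrArg α.proj hx, ?_⟩
    rintro ⟨y⟩ hy
    have h1 : α.r (y * a) b := α.proj_eq.1 hy
    have h2 : x * a = b := hx
    exact α.proj_eq.2 (α.cancel (α.refl a) (h2.symm ▸ h1))

theorem proj_mul (α : Congruence S) (x y : S) : α.proj (x * y) = α.proj x * α.proj y := rfl

theorem proj_one (α : Congruence S) : α.proj 1 = 1 := rfl

/-- The congruence on `S` that is the inverse image of a congruence on `S / α`. -/
def pullback (α : Congruence S) (β : Congruence α.Quot) : Congruence S :=
  mk' ⟨fun x y => β.r (α.proj x) (α.proj y), ⟨fun _ => β.refl _, β.symm, β.trans⟩⟩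
    (fun _ _ _ _ h h' => β.mul h h') (fun _ _ _ _ h' h => β.cancel h' h)

/-- `γ` centralizes `β` by means of the centering congruence `δ`, a congruence on the right
loop `β`. -/
structure Centralizes (γ β : Congruence S) (δ : Congruence β.graph) : Prop where
  fst : ∀ {x y u v : S} (h : β.r x y) (h' : β.r u v), δ.r (β.pair h) (β.pair h') → γ.r x u
  bijOn : ∀ {x y : S} (h : β.r x y),
    Set.BijOn (fun q : β.graph => q.1.1) {q | δ.r (β.pair h) q} {u | γ.r x u}
  diag : ∀ {x y : S}, γ.r x y → δ.r (β.pair (β.refl x)) (β.pair (β.refl y))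
  swap : ∀ {x y u v : S} (h : β.r x y) (h' : β.r u v), δ.r (β.pair h) (β.pair h') →
    δ.r (β.pair (β.symm h)) (β.pair (β.symm h'))
  comp : ∀ {x y z u v w : S} (h : β.r x y) (h' : β.r u v) (k : β.r y z) (k' : β.r v w),
    δ.r (β.pair h) (β.pair h') → δ.r (β.pair k) (β.pair k') →
    δ.r (β.pair (β.trans h k)) (β.pair (β.trans h' k'))

/-- A congruence is central if it is centralized by `S × S`. -/
def IsCentral (α : Congruence S) : Prop :=
  ∃ δ : Congruence α.graph, Centralizes (total S) α δ

end Congruence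

/-! Existence of a greatest central congruence. -/

section CenterExists

variable {S : Type*} [RightLoop S]

/-- Auxiliary elementwise condition, used to show that a greatest central congruence exists. -/
structure CentralElt (z : S) : Prop where
  comm : ∀ x : S, z * x = x * z
  assoc : ∀ x y : S, (z * x) * y = z * (x * y)
  move : ∀ x y : S, x * (z * y) = z * (x * y)

theorem CentralElt.one : CentralElt (1 : S) := by
  constructor <;> simp

theorem CentralElt.mul {z w : S} (hz : CentralElt z) (hw : CentralElt w) :
    CentralElt (z * w) where
  comm x := by rw [hz.assoc, hw.comm, ← hz.move]
  assoc x y := by rw [hz.assoc, hz.assoc, hw.assoc, hz.assoc]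
  move x y := by rw [hz.assoc, hz.move, hw.move, hz.assoc]

theorem CentralElt.cancel_left {z x y : S} (hz : CentralElt z) (h : z * x = z * y) : x = y := by
  rw [hz.comm, hz.comm] at h
  exact RightLoop.cancel h

theorem CentralElt.exists_inv {z : S} (hz : CentralElt z) :
    ∃ w : S, CentralElt w ∧ w * z = 1 ∧ z * w = 1 := by
  obtain ⟨w, hw, -⟩ := existsUnique_mul_eq z (1 : S)
  have hw : w * z = 1 := hw
  have hw' : z * w = 1 := by rw [hz.comm, hw]
  have key : ∀ x, z * (w * x) = x := fun x => by rw [← hz.assoc, hw', one_mul]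
  refine ⟨w, ⟨fun x => ?_, fun x y => ?_, fun x y => ?_⟩, hw, hw'⟩
  · apply hz.cancel_left
    rw [key, ← hz.move, hw', mul_one]
  · apply hz.cancel_left
    rw [← hz.assoc, key, key]
  · apply hz.cancel_left
    rw [← hz.move, key, key]

theorem CentralElt.mul_mul {z w : S} (hz : CentralElt z) (hw : CentralElt w) (x y : S) :
    (z * x) * (w * y) = (z * w) * (x * y) := by
  rw [hz.assoc, hw.move, hz.assoc]

variable (S) in
/-- The congruence whose classes are the orbits of the elements satisfying `CentralElt`. -/
def orbitCongruence : Congruence S :=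
  Congruence.mk'
    ⟨fun x y => ∃ z : S, CentralElt z ∧ x = z * y,
      ⟨fun x => ⟨1, CentralElt.one, (one_mul x).symm⟩,
       by
        rintro x y ⟨z, hz, rfl⟩
        obtain ⟨w, hw, h1, -⟩ := hz.exists_inv
        exact ⟨w, hw, by rw [← hw.assoc, h1, one_mul]⟩,
       by
        rintro x y t ⟨z, hz, rfl⟩ ⟨w, hw, rfl⟩
        exact ⟨z * w, hz.mul hw, (hz.assoc _ _).symm⟩⟩⟩
    (by
      rintro x y a b ⟨z, hz, rfl⟩ ⟨w, hw, rfl⟩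
      exact ⟨z * w, hz.mul hw, hz.mul_mul hw _ _⟩)
    (by
      rintro x y a b ⟨s, hs, rfl⟩ ⟨w, hw, h⟩
      obtain ⟨s', hs', h1, -⟩ := hs.exists_inv
      refine ⟨w * s', hw.mul hs', RightLoop.cancel (a := s * b) ?_⟩
      rw [h, (hw.mul hs').mul_mul hs, hw.assoc, h1, mul_one])

theorem orbitCongruence_isCentral : (orbitCongruence S).IsCentral := by
  let β := orbitCongruence S
  have hval : ∀ q : β.graph, ∃ z : S, CentralElt z ∧ q.1.1 = z * q.1.2 := fun q => q.2
  refine ⟨Congruence.mk' ⟨fun q q' : β.graph => ∃ z : S, CentralElt z ∧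
    q.1.1 = z * q.1.2 ∧ q'.1.1 = z * q'.1.2, ⟨?_, ?_, ?_⟩⟩ ?_ ?_, ?_⟩
  · intro q
    obtain ⟨z, hz, h⟩ := hval q
    exact ⟨z, hz, h, h⟩
  · rintro q q' ⟨z, hz, h, h'⟩
    exact ⟨z, hz, h', h⟩
  · rintro q q' q'' ⟨z, hz, h, h'⟩ ⟨w, hw, k, k'⟩
    obtain rfl : z = w := RightLoop.cancel (h'.symm.trans k)
    exact ⟨z, hz, h, k'⟩
  · rintro q q' t t' ⟨z, hz, h, h'⟩ ⟨w, hw, k, k'⟩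
    refine ⟨z * w, hz.mul hw, ?_, ?_⟩
    · change q.1.1 * t.1.1 = z * w * (q.1.2 * t.1.2)
      rw [h, k, hz.mul_mul hw]
    · change q'.1.1 * t'.1.1 = z * w * (q'.1.2 * t'.1.2)
      rw [h', k', hz.mul_mul hw]
  · rintro q q' t t' ⟨w, hw, k, k'⟩ ⟨z, hz, h, h'⟩
    replace h : q.1.1 * t.1.1 = z * (q.1.2 * t.1.2) := h
    replace h' : q'.1.1 * t'.1.1 = z * (q'.1.2 * t'.1.2) := h'
    obtain ⟨a, ha, e⟩ := hval q
    obtain ⟨b, hb, e'⟩ := hval q'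
    rw [e, k, ha.mul_mul hw] at h
    rw [e', k', hb.mul_mul hw] at h'
    obtain rfl : a = b := RightLoop.cancel ((RightLoop.cancel h).trans (RightLoop.cancel h').symm)
    exact ⟨a, ha, e, e'⟩
  · constructor
    · intros
      trivial
    · rintro x y ⟨z, hz, rfl⟩
      refine ⟨fun _ _ => trivial, ?_, ?_⟩
      · rintro ⟨⟨u, v⟩, hq⟩ ⟨w, hw, h, h'⟩ ⟨⟨u', v'⟩, hq'⟩ ⟨w', hw', k, k'⟩ (e : u = u')
        replace h' : u = w * v := h'
        replace k' : u' = w' * v' := k'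
        obtain rfl : w = w' := RightLoop.cancel (h.symm.trans k)
        have : v = v' := hw.cancel_left (by rw [← h', ← k', e])
        subst e this
        rfl
      · intro u _
        obtain ⟨w, hw, h1, h2⟩ := hz.exists_inv
        have hu : u = z * (w * u) := by rw [← hz.assoc, h2, one_mul]
        exact ⟨⟨(u, w * u), z, hz, hu⟩, ⟨z, hz, rfl, hu⟩, rfl⟩
    · intro x y _
      exact ⟨1, CentralElt.one, (one_mul x).symm, (one_mul y).symm⟩
    · rintro x y u v h h' ⟨z, hz, k, k'⟩
      replace k : x = z * y := k
      replace k' : u = z * v := k'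
      obtain ⟨w, hw, h1, h2⟩ := hz.exists_inv
      refine ⟨w, hw, ?_, ?_⟩
      · change y = w * x
        rw [k, ← hw.assoc, h1, one_mul]
      · change v = w * u
        rw [k', ← hw.assoc, h1, one_mul]
    · rintro x y t u v s h h' k k' ⟨z, hz, e, e'⟩ ⟨w, hw, f, f'⟩
      replace e : x = z * y := e
      replace e' : u = z * v := e'
      replace f : y = w * t := f
      replace f' : v = w * s := f'
      refine ⟨z * w, hz.mul hw, ?_, ?_⟩
      · change x = z * w * t
        rw [e, f, hz.assoc]
      · change u = z * w * s
        rw [e', f', hz.assoc]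

theorem Congruence.IsCentral.centralElt {α : Congruence S} (hα : α.IsCentral) {z : S}
    (hz : α.r 1 z) : CentralElt z := by
  obtain ⟨δ, hδ⟩ := hα
  have uniq : ∀ {u v v' : S} (h : α.r u v) (h' : α.r u v'),
      δ.r (α.pair hz) (α.pair h) → δ.r (α.pair hz) (α.pair h') → v = v' := by
    intro u v v' h h' k k'
    have := (hδ.bijOn hz).injOn k k' rfl
    exact congrArg (fun q : α.graph => q.1.2) this
  have d : ∀ x : S, δ.r (1 : α.graph) (α.pair (α.refl x)) := fun x => hδ.diag (x := 1) trivial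
  have hR : ∀ {u v : S} (h : α.r u v) (x : S), δ.r (α.pair hz) (α.pair h) →
      δ.r (α.pair hz) (α.pair (α.mul h (α.refl x))) := by
    intro u v h x k
    have := δ.mul k (d x)
    rwa [mul_one] at this
  have hL : ∀ {u v : S} (h : α.r u v) (x : S), δ.r (α.pair hz) (α.pair h) →
      δ.r (α.pair hz) (α.pair (α.mul (α.refl x) h)) := by
    intro u v h x k
    have := δ.mul (d x) k
    rwa [one_mul] at this
  have h0 := δ.refl (α.pair hz)
  have hx : ∀ x : S, ∃ h : α.r x (z * x), δ.r (α.pair hz) (α.pair h) := by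
    intro x
    have h1 := hR hz x h0
    have h2 : α.r x (z * x) := by simpa using α.mul hz (α.refl x)
    refine ⟨h2, ?_⟩
    have : α.pair (α.mul hz (α.refl x)) = α.pair h2 := Subtype.ext (Prod.ext (one_mul x) rfl)
    rwa [this] at h1
  refine ⟨fun x => ?_, fun x y => ?_, fun x y => ?_⟩
  · obtain ⟨h, k⟩ := hx x
    have h1 := hL hz x h0
    have h2 : α.r x (x * z) := by simpa using α.mul (α.refl x) hz
    have : α.pair (α.mul (α.refl x) hz) = α.pair h2 := Subtype.ext (Prod.ext (mul_one x) rfl)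
    rw [this] at h1
    exact uniq h h2 k h1
  · obtain ⟨h, k⟩ := hx x
    obtain ⟨h', k'⟩ := hx (x * y)
    exact uniq _ h' (hR h y k) k'
  · obtain ⟨h, k⟩ := hx y
    obtain ⟨h', k'⟩ := hx (x * y)
    exact uniq _ h' (hL h x k) k'

theorem Congruence.IsCentral.le_orbitCongruence {α : Congruence S} (hα : α.IsCentral) {x y : S}
    (h : α.r x y) : (orbitCongruence S).r x y := by
  obtain ⟨z, hz, -⟩ := existsUnique_mul_eq y x
  have hz : z * y = x := hz
  refine ⟨z, hα.centralElt (α.symm (α.cancel (α.refl y) ?_)), hz.symm⟩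
  rwa [hz, one_mul]

variable (S) in
theorem exists_greatest_central : ∃ ζ : Congruence S, ζ.IsCentral ∧
    ∀ α : Congruence S, α.IsCentral → ∀ x y : S, α.r x y → ζ.r x y :=
  ⟨orbitCongruence S, orbitCongruence_isCentral, fun _ hα _ _ h => hα.le_orbitCongruence h⟩

end CenterExists

/-- The center congruence `ζ(S)`: the greatest central congruence on `S`. -/
noncomputable def centerCongruence (S : Type*) [RightLoop S] : Congruence S :=
  Classical.choose (exists_greatest_central S)

theorem centerCongruence_spec (S : Type*) [RightLoop S] : (centerCongruence S).IsCentral ∧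
    ∀ α : Congruence S, α.IsCentral → ∀ x y : S, α.r x y → (centerCongruence S).r x y :=
  Classical.choose_spec (exists_greatest_central S)

/-- The center `Z(S)`: the class of the identity under the center congruence. -/
def center (S : Type*) [RightLoop S] : Set S := {x | (centerCongruence S).r x 1}

/-- The congruences of the upper central series: equality at stage `0`, and at stage `i + 1` the
inverse image of the center congruence of the quotient by stage `i`. -/
noncomputable def upperCentralCongruence (S : Type*) [RightLoop S] : ℕ → Congruence S
  | 0 => Congruence.equality S
  | i + 1 => (upperCentralCongruence S i).pullback
      (centerCongruence (upperCentralCongruence S i).Quot)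

/-- The terms `Z_i` of the upper central series: `Z_0 = {1}` and `Z_{i+1} / Z_i = Z(S / Z_i)`. -/
def upperCentralSeries (S : Type*) [RightLoop S] (i : ℕ) : Set S :=
  {x | (upperCentralCongruence S i).r x 1}

theorem upperCentralSeries_zero (S : Type*) [RightLoop S] : upperCentralSeries S 0 = {1} := rfl

theorem upperCentralSeries_succ (S : Type*) [RightLoop S] (i : ℕ) :
    (upperCentralCongruence S i).proj '' upperCentralSeries S (i + 1) =
      center (upperCentralCongruence S i).Quot := by
  ext q
  constructor
  · rintro ⟨x, hx, rfl⟩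
    exact hx
  · intro hq
    obtain ⟨x, rfl⟩ := (upperCentralCongruence S i).proj_surjective q
    exact ⟨x, hq, rfl⟩

/-- A right loop is nilpotent if its upper central series reaches the whole right loop. -/
def IsNilpotent (S : Type*) [RightLoop S] : Prop :=
  ∃ n : ℕ, upperCentralSeries S n = Set.univ

end RightLoop

/-- `S` is a (right) transversal of `H` in `G`: it contains exactly one element of each right coset
`H g`, and the identity from the coset `H`. -/
structure IsTransversal {G : Type*} [Group G] (H : Subgroup G) (S : Set G) : Prop where
  isComplement : Subgroup.IsComplement (H : Set G) S
  one_mem : (1 : G) ∈ S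

namespace IsTransversal

variable {G : Type*} [Group G] {H : Subgroup G} {S : Set G}

theorem existsUnique (hS : IsTransversal H S) (g : G) : ∃! s : S, g * (s : G)⁻¹ ∈ H :=
  Subgroup.isComplement_iff_existsUnique_mul_inv_mem.1 hS.isComplement g

/-- The element of `S` in the right coset `H g`. -/
noncomputable def rep (hS : IsTransversal H S) (g : G) : S :=
  Classical.choose (hS.existsUnique g).exists

theorem rep_mem (hS : IsTransversal H S) (g : G) : g * (hS.rep g : G)⁻¹ ∈ H :=
  Classical.choose_spec (hS.existsUnique g).exists

theorem rep_eq_iff (hS : IsTransversal H S) {g : G} {s : S} :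
    hS.rep g = s ↔ g * (s : G)⁻¹ ∈ H :=
  ⟨fun h => h ▸ hS.rep_mem g, fun h => (hS.existsUnique g).unique (hS.rep_mem g) h⟩

/-- The induced right loop structure on `S`: `x ∘ y` is the element of `S` in `H x y`. -/
noncomputable abbrev rightLoop (hS : IsTransversal H S) : RightLoop S where
  mul x y := hS.rep ((x : G) * (y : G))
  one := ⟨1, hS.one_mem⟩
  one_mul x := hS.rep_eq_iff.2 (by
    change (1 : G) * (x : G) * (x : G)⁻¹ ∈ H
    simp [H.one_mem])
  mul_one x := hS.rep_eq_iff.2 (by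
    change (x : G) * (1 : G) * (x : G)⁻¹ ∈ H
    simp [H.one_mem])
  existsUnique_mul_eq a b := by
    have key : ∀ x : S, hS.rep ((x : G) * (a : G)) = b ↔ hS.rep ((b : G) * (a : G)⁻¹) = x := by
      intro x
      rw [hS.rep_eq_iff, hS.rep_eq_iff, ← H.inv_mem_iff]
      simp [mul_assoc]
    exact ⟨hS.rep ((b : G) * (a : G)⁻¹), (key _).2 rfl, fun y hy => ((key y).1 hy).symm⟩

/-- A transversal is nilpotent if it is nilpotent for the induced right loop structure. -/
def IsNilpotent (hS : IsTransversal H S) : Prop :=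
  @RightLoop.IsNilpotent S hS.rightLoop

end IsTransversal

/-! The group $G$ acts on the right cosets of $H$, hence on the transversal $S$. The kernel of this
action lies in the core of $H$, so the action is faithful. An element $s \in S$ acts, up to
inversion, as $x \mapsto x \circ s$. Since $S$ generates $G$, this embeds $G$ into the group
generated by the right multiplications of $(S,\circ)$. It is therefore enough that this group is a
$p$-group when the right loop $L$ is nilpotent of order $p^n$ (`isPGroup_rightMulGroup`).

Let $f$ lie in that group and preserve every class of the center congruence. For fixed $x$, $f(x) =
zx$ with $z$ central, and left multiplication by $z$ commutes with all right multiplications, so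
$f^m$ and the $m$-th power of this left multiplication agree at $x$. The permutations commuting with
all right multiplications form a group acting freely on $L$, so their orders divide $|L|$ and
$f^{|L|} = 1$. Applied to the quotients $L/\mathcal Z_i$, whose orders divide $p^n$, this moves a
power of $f$ one step down the upper central series at the cost of a $p$-power exponent, until stage
$0$, where the power is the identity. -/

namespace RightLoop

/-! ### Right multiplications, their centralizer, and the center congruence -/

variable {L : Type*} [RightLoop L]

/-- Right multiplication by `a` as a permutation. -/
noncomputable def rightMul (a : L) : Equiv.Perm L :=
  Equiv.ofBijective (fun x => x * a)
    ⟨fun _ _ h => RightLoop.cancel h, fun b => (existsUnique_mul_eq a b).exists⟩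

@[simp]
theorem rightMul_apply (a x : L) : rightMul a x = x * a := rfl

variable (L) in
/-- The group of permutations generated by the right multiplications. -/
def rightMulGroup : Subgroup (Equiv.Perm L) :=
  Subgroup.closure (Set.range rightMul)

variable (L) in
/-- The centralizer of the right multiplications in the symmetric group. -/
def rightMulCentralizer : Subgroup (Equiv.Perm L) :=
  Subgroup.centralizer (Set.range rightMul)

theorem mem_rightMulCentralizer {c : Equiv.Perm L} :
    c ∈ rightMulCentralizer L ↔ ∀ x y : L, c (x * y) = c x * y := by
  simp only [rightMulCentralizer, Subgroup.mem_centralizer_iff, Set.forall_mem_range]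
  constructor
  · intro h x y
    exact (congrArg (fun f : Equiv.Perm L => f x) (h y)).symm
  · intro h y
    ext x
    exact (h x y).symm

/-- The centralizer of the right multiplications acts freely, so its order divides that of `L`. -/
theorem card_rightMulCentralizer_dvd : Nat.card (rightMulCentralizer L) ∣ Nat.card L := by
  -- An element `c` of the centralizer satisfies `c y = c 1 * y`, so it is determined by `c 1`. A
  -- fixed point `x` gives `c 1 * x = x`, hence `c 1 = 1`.
  have hfree : ∀ x : L, MulAction.stabilizer (rightMulCentralizer L) x = ⊥ := by
    intro x
    refine (Subgroup.eq_bot_iff_forall _).2 fun c hc => ?_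
    have hmul := mem_rightMulCentralizer.1 c.2
    have hx : c.1 x = x := hc
    have h1 : c.1 1 = 1 := by
      refine cancel (a := x) ?_
      rw [← hmul, one_mul, hx]
    refine Subtype.ext (Equiv.ext fun y => ?_)
    have := hmul 1 y
    rw [h1, one_mul] at this
    exact this
  rw [Nat.card_congr (MulAction.selfEquivOrbitsQuotientProd hfree), Nat.card_prod]
  exact dvd_mul_left _ _

/-- Commuting with the generators already forces commuting with the group they generate. -/
theorem commute_of_mem_rightMulGroup {f c : Equiv.Perm L} (hf : f ∈ rightMulGroup L)
    (hc : c ∈ rightMulCentralizer L) : Commute f c := by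
  rw [rightMulCentralizer, ← Subgroup.centralizer_closure] at hc
  exact Subgroup.mem_centralizer_iff.1 hc f hf

/-- Left multiplication by a central element lies in the centralizer of the right
multiplications. -/
theorem CentralElt.exists_perm {z : L} (hz : CentralElt z) :
    ∃ c ∈ rightMulCentralizer L, ∀ x, c x = z * x := by
  obtain ⟨w, hw, hwz, hzw⟩ := hz.exists_inv
  let c : Equiv.Perm L :=
    { toFun := fun x => z * x
      invFun := fun x => w * x
      left_inv := fun x => (hw.assoc z x).symm.trans (by rw [hwz, one_mul])
      right_inv := fun x => (hz.assoc w x).symm.trans (by rw [hzw, one_mul]) }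
  exact ⟨c, mem_rightMulCentralizer.2 fun x y => (hz.assoc x y).symm, fun _ => rfl⟩

/-- An element of the right multiplication group that fixes all classes of the center congruence
has order dividing that of `L`. -/
theorem pow_card_eq_one_of_forall_centerCongruence {f : Equiv.Perm L}
    (hf : f ∈ rightMulGroup L) (h : ∀ x, (centerCongruence L).r (f x) x) :
    f ^ Nat.card L = 1 := by
  ext x
  -- Both `z` and `c` depend on `x`: `f` need not be one left multiplication globally, but it agrees
  -- with `c` at `x`, and commutation extends this to all powers.
  obtain ⟨z, hz, hzx⟩ := (centerCongruence_spec L).1.le_orbitCongruence (h x)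
  obtain ⟨c, hc, hcx⟩ := hz.exists_perm
  have hpow : ∀ m : ℕ, (f ^ m) x = (c ^ m) x := by
    intro m
    induction m with
    | zero => rfl
    | succ m ih =>
      rw [pow_succ', Equiv.Perm.mul_apply, ih, pow_succ, Equiv.Perm.mul_apply, hcx, ← hzx]
      exact congrArg (fun g : Equiv.Perm L => g x)
        (commute_of_mem_rightMulGroup hf (Subgroup.pow_mem _ hc m)).eq
  have hc1 : c ^ Nat.card L = 1 :=
    orderOf_dvd_iff_pow_eq_one.1
      ((Subgroup.orderOf_dvd_natCard _ hc).trans card_rightMulCentralizer_dvd)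
  rw [hpow, hc1]

/-! ### Passage to quotients and descent along the upper central series -/

/-- All classes of a congruence have the same size. -/
theorem Congruence.card_quot_dvd (α : Congruence L) : Nat.card α.Quot ∣ Nat.card L := by
  -- Right multiplication by `a` carries the class of the identity bijectively onto the class of
  -- `a`. Right cancellation in the quotient gives the converse inclusion.
  have e : ∀ q : α.Quot, Nonempty ({x // α.proj x = 1} ≃ {x // α.proj x = q}) := by
    intro q
    obtain ⟨a, rfl⟩ := α.proj_surjective q
    refine ⟨(rightMul a).subtypeEquiv fun x => ?_⟩
    rw [rightMul_apply, α.proj_mul]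
    exact ⟨fun h => by rw [h, one_mul], fun h => RightLoop.cancel (h.trans (one_mul _).symm)⟩
  rw [← Nat.card_congr (Equiv.sigmaFiberEquiv α.proj),
    ← Nat.card_congr (Equiv.sigmaCongrRight fun q => (e q).some),
    Nat.card_congr (Equiv.sigmaEquivProd _ _), Nat.card_prod]
  exact dvd_mul_right _ _

/-- The right multiplication group acts on each quotient through that of the quotient. -/
theorem Congruence.exists_mem_rightMulGroup_quot (α : Congruence L) {f : Equiv.Perm L}
    (hf : f ∈ rightMulGroup L) :
    ∃ f' ∈ rightMulGroup α.Quot, ∀ x, α.proj (f x) = f' (α.proj x) := by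
  induction hf using Subgroup.closure_induction with
  | mem f hf =>
    obtain ⟨a, rfl⟩ := hf
    exact ⟨rightMul (α.proj a), Subgroup.subset_closure ⟨_, rfl⟩, fun _ => rfl⟩
  | one => exact ⟨1, one_mem _, fun _ => rfl⟩
  | mul f g _ _ hf hg =>
    obtain ⟨f', hf', hf⟩ := hf
    obtain ⟨g', hg', hg⟩ := hg
    exact ⟨f' * g', mul_mem hf' hg', fun x => by
      rw [Equiv.Perm.mul_apply, Equiv.Perm.mul_apply, hf, hg]⟩
  | inv f _ hf =>
    obtain ⟨f', hf', hf⟩ := hf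
    exact ⟨f'⁻¹, inv_mem hf', fun x => by
      rw [Equiv.Perm.eq_inv_iff_eq, ← hf, ← Equiv.Perm.mul_apply, mul_inv_cancel, Equiv.Perm.one_apply]⟩

theorem proj_pow_apply (α : Congruence L) {f : Equiv.Perm L} {f' : Equiv.Perm α.Quot}
    (h : ∀ x, α.proj (f x) = f' (α.proj x)) (m : ℕ) (x : L) :
    α.proj ((f ^ m) x) = (f' ^ m) (α.proj x) := by
  induction m with
  | zero => rfl
  | succ m ih => rw [pow_succ', pow_succ', Equiv.Perm.mul_apply, Equiv.Perm.mul_apply, h, ih]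

/-- If `f` fixes the classes at stage `i + 1` of the upper central series, then a suitable power
fixes the classes at stage `i`. -/
theorem pow_card_upperCentralCongruence (i : ℕ) {f : Equiv.Perm L} (hf : f ∈ rightMulGroup L)
    (h : ∀ x, (upperCentralCongruence L (i + 1)).r (f x) x) (x : L) :
    (upperCentralCongruence L i).r ((f ^ Nat.card (upperCentralCongruence L i).Quot) x) x := by
  let α := upperCentralCongruence L i
  obtain ⟨f', hf', hff'⟩ := α.exists_mem_rightMulGroup_quot hf
  -- Stage `i + 1` is the inverse image of the center congruence of the quotient by stage `i`, so
  -- `h` transfers to the induced permutation `f'`.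
  have hcenter : ∀ q, (centerCongruence α.Quot).r (f' q) q := by
    intro q
    obtain ⟨y, rfl⟩ := α.proj_surjective q
    rw [← hff']
    exact h y
  refine α.proj_eq.1 ?_
  rw [proj_pow_apply α hff', pow_card_eq_one_of_forall_centerCongruence hf' hcenter]
  rfl

/-- The right multiplication group of a nilpotent right loop of order `p ^ n` is a `p`-group. -/
theorem isPGroup_rightMulGroup (hnil : RightLoop.IsNilpotent L) {p n : ℕ} (hp : p.Prime)
    (hcard : Nat.card L = p ^ n) : IsPGroup p (rightMulGroup L) := by
  obtain ⟨N, hN⟩ := hnil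
  have htotal : ∀ x y, (upperCentralCongruence L N).r x y := fun x y =>
    Congruence.trans _ (hN.symm ▸ Set.mem_univ x : x ∈ upperCentralSeries L N)
      (Congruence.symm _ (hN.symm ▸ Set.mem_univ y : y ∈ upperCentralSeries L N))
  rintro ⟨f, hf⟩
  -- Here `j` counts steps down from the top stage `N`, where there is only one class and `f` itself
  -- works. One exponent `k` serves all `x`.
  have key : ∀ j ≤ N, ∃ k : ℕ, ∀ x, (upperCentralCongruence L (N - j)).r ((f ^ p ^ k) x) x := by
    intro j
    induction j with
    | zero => exact fun _ => ⟨0, fun x => htotal _ _⟩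
    | succ j ih =>
      intro hj
      obtain ⟨k, hk⟩ := ih (by omega)
      -- The order of the quotient by the lower stage divides $p^n$, so the exponent needed for this
      -- step is a power of `p`.
      obtain ⟨m, -, hm⟩ := (Nat.dvd_prime_pow hp).1
        (hcard ▸ (upperCentralCongruence L (N - (j + 1))).card_quot_dvd)
      rw [show N - j = N - (j + 1) + 1 by omega] at hk
      refine ⟨k + m, fun x => ?_⟩
      have := pow_card_upperCentralCongruence _ (Subgroup.pow_mem _ hf _) hk x
      rwa [hm, ← pow_mul, ← pow_add] at this
  obtain ⟨k, hk⟩ := key N le_rfl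
  rw [Nat.sub_self] at hk
  -- Stage `0` is equality, so `hk` says that `f ^ p ^ k` fixes every point.
  exact ⟨k, Subtype.ext (Equiv.ext hk)⟩

end RightLoop

/-! ### The coset action of the group on the transversal -/

namespace IsTransversal

variable {G : Type*} [Group G] {H : Subgroup G} {S : Set G}

/-- An element and its representative span the same right coset of `H`, and right multiplication
respects right cosets. This makes the action on cosets an action on `S`. -/
theorem rep_rep_mul (hS : IsTransversal H S) (a b : G) :
    hS.rep ((hS.rep a : G) * b) = hS.rep (a * b) := by
  refine (hS.rep_eq_iff.2 ?_).symm
  simpa [mul_assoc] using H.mul_mem (hS.rep_mem a) (hS.rep_mem ((hS.rep a : G) * b))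

theorem rep_coe (hS : IsTransversal H S) (s : S) : hS.rep (s : G) = s :=
  hS.rep_eq_iff.2 (by simp [H.one_mem])

/-- The action of `G` on the right cosets of `H`, transported to the transversal. -/
noncomputable def permHom (hS : IsTransversal H S) : G →* Equiv.Perm S where
  toFun g :=
    -- Right multiplication on cosets is a right action; the inverse makes it a homomorphism.
    { toFun := fun x => hS.rep ((x : G) * g⁻¹)
      invFun := fun x => hS.rep ((x : G) * g)
      left_inv := fun x => by simp [rep_rep_mul, rep_coe]
      right_inv := fun x => by simp [rep_rep_mul, rep_coe] }
  map_one' := by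
    ext x
    simp [rep_coe]
  map_mul' g h := by
    ext x
    simp [rep_rep_mul, mul_assoc]

theorem permHom_apply (hS : IsTransversal H S) (g : G) (x : S) :
    hS.permHom g x = hS.rep ((x : G) * g⁻¹) := rfl

/-- If `g` fixes the coset of `b`, then `b * g * b⁻¹` lies in `H`. For `g` in the kernel this holds
for every `b`. -/
theorem ker_permHom_le (hS : IsTransversal H S) : hS.permHom.ker ≤ H.normalCore := by
  intro g hg b
  have h := hS.rep_eq_iff.1 (congrArg (fun f : Equiv.Perm S => f (hS.rep b)) hg :
    hS.rep ((hS.rep b : G) * g⁻¹) = hS.rep b)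
  have hb := hS.rep_mem b
  -- With `s = hS.rep b`, this product is `(b s⁻¹)(s g⁻¹ s⁻¹)⁻¹(b s⁻¹)⁻¹ = b g b⁻¹`.
  have := H.mul_mem (H.mul_mem hb (H.inv_mem h)) (H.inv_mem hb)
  simpa [mul_assoc] using this

/-- It suffices to check the generators in `S`: the inverse of the permutation attached to `s` sends
`x` to the representative of `x * s`, which is the loop product by definition. -/
theorem permHom_mem_rightMulGroup (hS : IsTransversal H S) (hgen : Subgroup.closure S = ⊤)
    (g : G) : hS.permHom g ∈ @RightLoop.rightMulGroup S hS.rightLoop := by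
  let _ := hS.rightLoop
  have hle : Subgroup.closure S ≤ (RightLoop.rightMulGroup S).comap hS.permHom := by
    refine (Subgroup.closure_le _).2 fun s hs => ?_
    have : (hS.permHom s)⁻¹ = RightLoop.rightMul (⟨s, hs⟩ : S) :=
      Equiv.ext fun _ => rfl
    change hS.permHom s ∈ RightLoop.rightMulGroup S
    rw [← inv_mem_iff, this]
    exact Subgroup.subset_closure ⟨_, rfl⟩
  exact hle (hgen ▸ Subgroup.mem_top g)

end IsTransversal

theorem mainTheorem7 {G : Type*} [Group G] [Finite G] (H : Subgroup G)
    (hcore : H.normalCore = ⊥) (S : Set G) (hS : IsTransversal H S)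
    (hgen : Subgroup.closure S = ⊤) (hnil : hS.IsNilpotent)
    (p n : ℕ) (hp : p.Prime) (hcard : Nat.card S = p ^ n) :
    IsPGroup p H ∧ IsPGroup p G := by
  let _ := hS.rightLoop
  -- Core-freeness enters only here, making the coset action faithful.
  have hinj : Function.Injective hS.permHom :=
    (MonoidHom.ker_eq_bot_iff _).1 (le_bot_iff.1 (hcore ▸ hS.ker_permHom_le))
  have hG : IsPGroup p G :=
    (RightLoop.isPGroup_rightMulGroup hnil hp hcard).of_injective
      (hS.permHom.codRestrict _ (hS.permHom_mem_rightMulGroup hgen))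
      fun _ _ h => hinj (congrArg Subtype.val h)
  exact ⟨hG.to_subgroup H, hG⟩
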